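/- Let $x,y,u,v$ be indeterminates and define the polynomials $P_n(x,y,u,v)\in\mathbb{Z}[x,y,u,v]$ ($n\ge 0$) by the following identity of formal power series in $t$: $$\sum_{n=0}^\infty P_n(x,y,u,v)\,t^n \;=\; \cfrac{1}{1-\cfrac{\alpha_1 t}{1-\cfrac{\alpha_2 t}{1-\cdots}}},\qquad \alpha_{2k-1}=x+(k-1)u,\quad \alpha_{2k}=y+(k-1)v\quad(k\ge 1),$$ where the infinite continued fraction is the coefficientwise limit of its finite truncations. For a permutation $\sigma$ of $[n]=\{1,\dots,n\}$, an index $i$ is a *record* if $\sigma(j)<\sigma(i)$ for all $j<i$, an *antirecord* if $\sigma(j)>\sigma(i)$ for all $j>i$, an *exclusive record* if it is a record and not an antirecord, and an *excedance* if $\sigma(i)>i$. Let $\mathrm{arec}(\sigma)$, $\mathrm{erec}(\sigma)$, $\mathrm{exc}(\sigma)$ and $\mathrm{cyc}(\sigma)$ be the numbers of antirecords, exclusive records, excedances and cycles (fixed points included) of $\sigma$. Then for every $n\ge 0$, $$\text{(a)}\quad P_n(x,y,u,v)=\sum_{\sigma\in\mathfrak{S}_n}x^{\mathrm{arec}(\sigma)}\,y^{\mathrm{erec}(\sigma)}\,u^{n-\mathrm{exc}(\sigma)-\mathrm{arec}(\sigma)}\,v^{\mathrm{exc}(\sigma)-\mathrm{erec}(\sigma)},$$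 $$\text{(b)}\quad P_n(x,y,u,v)=\sum_{\sigma\in\mathfrak{S}_n}x^{\mathrm{cyc}(\sigma)}\,y^{\mathrm{erec}(\sigma)}\,u^{n-\mathrm{exc}(\sigma)-\mathrm{cyc}(\sigma)}\,v^{\mathrm{exc}(\sigma)-\mathrm{erec}(\sigma)},$$ where all exponents are nonnegative, that is, $\mathrm{erec}(\sigma)\le\mathrm{exc}(\sigma)$, $\mathrm{exc}(\sigma)+\mathrm{arec}(\sigma)\le n$ and $\mathrm{exc}(\sigma)+\mathrm{cyc}(\sigma)\le n$ for all $\sigma\in\mathfrak{S}_n$. -/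

import Mathlib

/-! ### Formal Stieltjes-type continued fractions

Everything takes place in the ring `R⟦X⟧` of formal power series; the variable `t` is `PowerSeries.X`.
The coefficients `α 1, α 2, α 3, …` are indexed from `1`; the value `α 0` is never used. -/

/-- The finite continued fraction with `N` levels, starting with the coefficient `α k`:
`1 / (1 - α k t / (1 - α (k+1) t / (1 - ⋯ / (1 - α (k+N-1) t))))`.
The reciprocal is the multiplicative inverse in `R⟦X⟧` of a series with constant term `1`. -/
noncomputable def sTruncation {R : Type*} [CommRing R] (α : ℕ → R) : ℕ → ℕ → PowerSeries R
  | 0, _ => 1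
  | N + 1, k =>
      PowerSeries.invOfUnit
        (1 - PowerSeries.C (α k) * PowerSeries.X * sTruncation α N (k + 1)) 1

/-- The infinite continued fraction
`1 / (1 - α 1 t / (1 - α 2 t / (1 - ⋯)))`, i.e. the coefficientwise limit of its truncations
`sTruncation α N 1` as `N → ∞`: the coefficient of `t ^ n` is the same in all truncations
with at least `n` levels, see `coeff_sTruncation_eq_sFraction`. -/
noncomputable def sFraction {R : Type*} [CommRing R] (α : ℕ → R) : PowerSeries R :=
  PowerSeries.mk fun n => PowerSeries.coeff n (sTruncation α n 1)

/-- The reciprocals in `sTruncation` are genuine reciprocals. -/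
theorem sTruncation_succ_mul {R : Type*} [CommRing R] (α : ℕ → R) (N k : ℕ) :
    (1 - PowerSeries.C (α k) * PowerSeries.X * sTruncation α N (k + 1)) *
      sTruncation α (N + 1) k = 1 := by
  rw [sTruncation]
  exact PowerSeries.mul_invOfUnit _ _ (by simp)

theorem sTruncation_dvd {R : Type*} [CommRing R] (α : ℕ → R) (n : ℕ) :
    ∀ N M k : ℕ, n ≤ N → n ≤ M →
      (PowerSeries.X : PowerSeries R) ^ (n + 1) ∣ sTruncation α N k - sTruncation α M k := by
  have base : ∀ N k : ℕ, (PowerSeries.X : PowerSeries R) ∣ sTruncation α N k - 1 := by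
    intro N k
    cases N with
    | zero => simp [sTruncation]
    | succ N =>
      have h := sTruncation_succ_mul α N k
      refine ⟨PowerSeries.C (α k) * sTruncation α N (k + 1) * sTruncation α (N + 1) k, ?_⟩
      linear_combination h
  induction n with
  | zero =>
    intro N M k _ _
    have h := dvd_sub (base N k) (base M k)
    simpa using h
  | succ n ih =>
    intro N M k hN hM
    obtain ⟨N, rfl⟩ := Nat.exists_eq_add_of_le' (Nat.one_le_of_lt hN)
    obtain ⟨M, rfl⟩ := Nat.exists_eq_add_of_le' (Nat.one_le_of_lt hM)
    obtain ⟨c, hc⟩ := ih N M (k + 1) (by omega) (by omega)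
    have h1 := sTruncation_succ_mul α N k
    have h2 := sTruncation_succ_mul α M k
    refine ⟨PowerSeries.C (α k) * c * sTruncation α (N + 1) k * sTruncation α (M + 1) k, ?_⟩
    linear_combination (sTruncation α (M + 1) k) * h1 - (sTruncation α (N + 1) k) * h2 +
      PowerSeries.C (α k) * PowerSeries.X * sTruncation α (N + 1) k *
        sTruncation α (M + 1) k * hc

/-- The truncations converge, coefficient by coefficient, to `sFraction α`. -/
theorem coeff_sTruncation_eq_sFraction {R : Type*} [CommRing R] (α : ℕ → R) (n N : ℕ)
    (h : n ≤ N) :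
    PowerSeries.coeff n (sTruncation α N 1) = PowerSeries.coeff n (sFraction α) := by
  have h1 := PowerSeries.X_pow_dvd_iff.mp (sTruncation_dvd α n N n 1 h le_rfl) n (Nat.lt_succ_self n)
  rw [map_sub, sub_eq_zero] at h1
  rw [h1, sFraction, PowerSeries.coeff_mk]

/-! ### The four-variable polynomials

The variables `x, y, u, v` are `X 0, X 1, X 2, X 3` in `ℤ[x, y, u, v]`. -/

/-- The coefficients `α (2k-1) = x + (k-1) u` and `α (2k) = y + (k-1) v` for `k ≥ 1`. -/
noncomputable def eulerianWeight (i : ℕ) : MvPolynomial (Fin 4) ℤ :=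
  if Odd i then MvPolynomial.X 0 + ((i / 2 : ℕ) : MvPolynomial (Fin 4) ℤ) * MvPolynomial.X 2
  else MvPolynomial.X 1 + ((i / 2 - 1 : ℕ) : MvPolynomial (Fin 4) ℤ) * MvPolynomial.X 3

theorem eulerianWeight_odd (k : ℕ) (hk : 1 ≤ k) : eulerianWeight (2 * k - 1) =
    MvPolynomial.X 0 + ((k - 1 : ℕ) : MvPolynomial (Fin 4) ℤ) * MvPolynomial.X 2 := by
  have h1 : Odd (2 * k - 1) := ⟨k - 1, by omega⟩
  have h2 : (2 * k - 1) / 2 = k - 1 := by omega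
  rw [eulerianWeight, if_pos h1, h2]

theorem eulerianWeight_even (k : ℕ) : eulerianWeight (2 * k) =
    MvPolynomial.X 1 + ((k - 1 : ℕ) : MvPolynomial (Fin 4) ℤ) * MvPolynomial.X 3 := by
  have h1 : ¬ Odd (2 * k) := by simp
  have h2 : 2 * k / 2 = k := by omega
  rw [eulerianWeight, if_neg h1, h2]

/-- `P_n(x, y, u, v)`: the coefficient of `t ^ n` in the continued fraction. -/
noncomputable def eulerianP (n : ℕ) : MvPolynomial (Fin 4) ℤ :=
  PowerSeries.coeff n (sFraction eulerianWeight)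

/-! ### Permutation statistics -/

/-- The index `i` is a record (left-to-right maximum). -/
def IsRecord {n : ℕ} (σ : Equiv.Perm (Fin n)) (i : Fin n) : Prop :=
  ∀ j : Fin n, j < i → σ j < σ i

/-- The index `i` is an antirecord (right-to-left minimum). -/
def IsAntirecord {n : ℕ} (σ : Equiv.Perm (Fin n)) (i : Fin n) : Prop :=
  ∀ j : Fin n, i < j → σ i < σ j

instance {n : ℕ} (σ : Equiv.Perm (Fin n)) : DecidablePred (IsRecord σ) :=
  fun i => inferInstanceAs (Decidable (∀ j : Fin n, j < i → σ j < σ i))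

instance {n : ℕ} (σ : Equiv.Perm (Fin n)) : DecidablePred (IsAntirecord σ) :=
  fun i => inferInstanceAs (Decidable (∀ j : Fin n, i < j → σ i < σ j))

/-- The number of antirecords. -/
def arec {n : ℕ} (σ : Equiv.Perm (Fin n)) : ℕ :=
  (Finset.univ.filter fun i => IsAntirecord σ i).card

/-- The number of exclusive records: records that are not antirecords. -/
def erec {n : ℕ} (σ : Equiv.Perm (Fin n)) : ℕ :=
  (Finset.univ.filter fun i => IsRecord σ i ∧ ¬ IsAntirecord σ i).card

/-- The number of excedances. -/
def exc {n : ℕ} (σ : Equiv.Perm (Fin n)) : ℕ :=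
  (Finset.univ.filter fun i => i < σ i).card

/-- The number of cycles, fixed points included: the number of classes of the relation
"`i` and `j` lie in the same cycle of `σ`". -/
noncomputable def cyc {n : ℕ} (σ : Equiv.Perm (Fin n)) : ℕ :=
  Nat.card (Quotient (Equiv.Perm.SameCycle.setoid σ))

/-! Both sides satisfy the same first-step recursion. On the analytic side, `pathSeries α k`
enumerates paths from height `k` to `0`, up steps having weight `1` and down steps from `i` weight
`α i * t`; at `k = 0` it is the continued fraction.

On the permutation side, read σ as a bijection from positions to values and scan value `0`, position
`0`, value `1`, position `1`, and so on. A position or value whose partner has not been scanned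
stays open. A matched pair is deleted and the rest relabelled, so at height `k` the open items are
the first `k / 2` positions and the first `(k + 1) / 2` values, and `Avoids` says that none of them
are matched together. A newly scanned item either stays open (up step) or is matched with an open
partner (down step). A value matched with one of `h + 1` open positions creates an excedance, which
is a record only for the leftmost one: total weight `y + h * v`. A position matched with one of the
`h + 1` values scanned so far creates a weak anti-excedance, with exactly one choice of weight `x`
and `h` of weight `u`. `sum_avoids_eq_coeff` carries this out.

For (a) the special choice is the least value, giving an antirecord. For (b) it is the value that
closes a cycle. To detect it, a permutation π remembers the deleted arrows: it sends each remaining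
value to the remaining position reached from it through deleted pairs. Cycles are then counted in `π
* σ`. -/

/-! ### Path recursion for the continued fraction -/

section ContinuedFraction

variable {R : Type*} [CommRing R] (α : ℕ → R)

/-- The infinite continued fraction starting with the coefficient `α k`. -/
noncomputable def sTail (k : ℕ) : PowerSeries R :=
  PowerSeries.mk fun n => PowerSeries.coeff n (sTruncation α n k)

theorem X_pow_dvd_sTail_sub (N k : ℕ) :
    (PowerSeries.X : PowerSeries R) ^ (N + 1) ∣ sTail α k - sTruncation α N k := by
  rw [PowerSeries.X_pow_dvd_iff]
  intro m hm
  have h := PowerSeries.X_pow_dvd_iff.mp (sTruncation_dvd α m m N k le_rfl (by omega)) m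
    (Nat.lt_succ_self m)
  simpa [sTail] using h

/-- Modulo `X ^ (n + 1)` the two tails may be replaced by truncations of depth `n + 1` and `n`, for
which the equation is the definition. -/
theorem sTail_eq (k : ℕ) :
    sTail α k = 1 + PowerSeries.C (α k) * PowerSeries.X * sTail α (k + 1) * sTail α k := by
  rw [← sub_eq_zero]
  ext n
  obtain ⟨c, hc⟩ := X_pow_dvd_sTail_sub α (n + 1) k
  obtain ⟨d, hd⟩ := X_pow_dvd_sTail_sub α n (k + 1)
  have h := sTruncation_succ_mul α n k
  have hdvd : (PowerSeries.X : PowerSeries R) ^ (n + 1) ∣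
      sTail α k - (1 + PowerSeries.C (α k) * PowerSeries.X * sTail α (k + 1) * sTail α k) := by
    refine ⟨PowerSeries.X * c * (1 - PowerSeries.C (α k) * PowerSeries.X * sTruncation α n (k + 1))
      - PowerSeries.C (α k) * PowerSeries.X * d * sTail α k, ?_⟩
    linear_combination h + hc * (1 - PowerSeries.C (α k) * PowerSeries.X * sTruncation α n (k + 1))
      - PowerSeries.C (α k) * PowerSeries.X * sTail α k * hd
  rw [PowerSeries.X_pow_dvd_iff.mp hdvd n (Nat.lt_succ_self n), map_zero]

/-- The generating function of weighted Dyck path suffixes starting at height `k`. -/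
noncomputable def pathSeries (k : ℕ) : PowerSeries R :=
  (∏ i ∈ Finset.range k, PowerSeries.C (α (i + 1)) * PowerSeries.X) *
    ∏ i ∈ Finset.range (k + 1), sTail α (i + 1)

theorem pathSeries_zero : pathSeries α 0 = sFraction α := by
  simp [pathSeries, sTail, sFraction]

theorem pathSeries_zero_eq : pathSeries α 0 = 1 + pathSeries α 1 := by
  have h := sTail_eq α 1
  simp only [pathSeries, Finset.prod_range_succ, Finset.prod_range_zero]
  linear_combination h

/-- Expanding the last factor `sTail α (k + 2)` once separates paths by their first step: its `1`
gives the down step, the other term the up step. -/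
theorem pathSeries_succ (k : ℕ) : pathSeries α (k + 1) =
    pathSeries α (k + 2) + PowerSeries.C (α (k + 1)) * PowerSeries.X * pathSeries α k := by
  have h := sTail_eq α (k + 2)
  simp only [pathSeries, Finset.prod_range_succ]
  linear_combination (∏ i ∈ Finset.range k, PowerSeries.C (α (i + 1)) * PowerSeries.X) *
    (PowerSeries.C (α (k + 1)) * PowerSeries.X) *
    (∏ i ∈ Finset.range k, sTail α (i + 1)) * sTail α (k + 1) * h

theorem coeff_pathSeries_of_lt {M k : ℕ} (h : M < k) :
    PowerSeries.coeff M (pathSeries α k) = 0 := by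
  refine PowerSeries.X_pow_dvd_iff.mp ?_ M h
  rw [pathSeries, Finset.prod_mul_distrib, Finset.prod_const, Finset.card_range]
  exact Dvd.dvd.mul_right (Dvd.intro_left _ rfl) _

theorem coeff_zero_pathSeries_zero : PowerSeries.coeff 0 (pathSeries α 0) = 1 := by
  rw [pathSeries_zero_eq, map_add, coeff_pathSeries_of_lt α one_pos]
  simp

theorem coeff_succ_pathSeries_zero (M : ℕ) : PowerSeries.coeff (M + 1) (pathSeries α 0) =
    PowerSeries.coeff (M + 1) (pathSeries α 1) := by
  rw [pathSeries_zero_eq, map_add, PowerSeries.coeff_one]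
  simp

theorem coeff_succ_pathSeries_succ (M k : ℕ) :
    PowerSeries.coeff (M + 1) (pathSeries α (k + 1)) =
      PowerSeries.coeff (M + 1) (pathSeries α (k + 2)) +
        α (k + 1) * PowerSeries.coeff M (pathSeries α k) := by
  rw [pathSeries_succ, map_add, mul_assoc, PowerSeries.coeff_C_mul, PowerSeries.coeff_succ_X_mul]

end ContinuedFraction

/-! ### Inserting and deleting a position-value pair -/

section Insertion

open Equiv

variable {m : ℕ}

/-- The permutation obtained from `σ` by inserting a new position `p` with the new value `q`. -/
def insertPerm (p q : Fin (m + 1)) (σ : Perm (Fin m)) : Perm (Fin (m + 1)) :=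
  (finSuccEquiv' p).trans ((Equiv.optionCongr σ).trans (finSuccEquiv' q).symm)

@[simp] theorem insertPerm_self (p q : Fin (m + 1)) (σ : Perm (Fin m)) :
    insertPerm p q σ p = q := by
  simp [insertPerm]

@[simp] theorem insertPerm_succAbove (p q : Fin (m + 1)) (σ : Perm (Fin m)) (a : Fin m) :
    insertPerm p q σ (p.succAbove a) = q.succAbove (σ a) := by
  simp [insertPerm]

theorem insertPerm_mul (p q r : Fin (m + 1)) (τ σ : Perm (Fin m)) :
    insertPerm q r τ * insertPerm p q σ = insertPerm p r (τ * σ) := by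
  ext i
  rcases Fin.eq_self_or_eq_succAbove p i with rfl | ⟨a, rfl⟩ <;> simp

theorem exists_eq_insertPerm {p q : Fin (m + 1)} {ρ : Perm (Fin (m + 1))} (h : ρ p = q) :
    ∃ σ, ρ = insertPerm p q σ := by
  let e : Option (Fin m) ≃ Option (Fin m) :=
    (finSuccEquiv' p).symm.trans (ρ.trans (finSuccEquiv' q))
  have he : e none = none := by simp [e, h]
  refine ⟨Equiv.removeNone e, ?_⟩
  have h2 : Equiv.optionCongr (Equiv.removeNone e) = e := by
    ext1 x
    cases x with
    | none => simp [he]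
    | some x =>
      have hx : ∃ y, e (some x) = some y := by
        rw [← Option.isSome_iff_exists, Option.isSome_iff_ne_none]
        intro h3
        exact Option.some_ne_none x (e.injective (h3.trans he.symm))
      rw [Equiv.optionCongr_apply, Option.map_some, Equiv.removeNone_some e hx]
  rw [insertPerm, h2]
  ext i
  simp [e]

theorem insertPerm_injective (p q : Fin (m + 1)) :
    Function.Injective (insertPerm p q) := by
  intro σ τ h
  ext1 a
  have := congrArg (fun ρ : Perm (Fin (m + 1)) => ρ (p.succAbove a)) h
  simpa using this

theorem sum_perm_eq_sum_position {R : Type*} [AddCommMonoid R] (q : Fin (m + 1))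
    (F : Perm (Fin (m + 1)) → R) :
    ∑ ρ, F ρ = ∑ p, ∑ σ, F (insertPerm p q σ) := by
  rw [← Fintype.sum_prod_type']
  symm
  refine Fintype.sum_bijective (fun z : Fin (m + 1) × Perm (Fin m) => insertPerm z.1 q z.2)
    ⟨?_, ?_⟩ _ _ fun _ => rfl
  · rintro ⟨p, σ⟩ ⟨p', σ'⟩ h
    dsimp only at h
    have h1 : p = p' := by
      apply (insertPerm p' q σ').injective
      rw [← h, insertPerm_self, h, insertPerm_self]
    subst h1
    rw [insertPerm_injective _ _ h]
  · intro ρ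
    obtain ⟨σ, hσ⟩ := exists_eq_insertPerm (show ρ (ρ⁻¹ q) = q by simp)
    exact ⟨(ρ⁻¹ q, σ), hσ.symm⟩

theorem sum_perm_eq_sum_value {R : Type*} [AddCommMonoid R] (p : Fin (m + 1))
    (F : Perm (Fin (m + 1)) → R) :
    ∑ ρ, F ρ = ∑ q, ∑ σ, F (insertPerm p q σ) := by
  rw [← Fintype.sum_prod_type']
  symm
  refine Fintype.sum_bijective (fun z : Fin (m + 1) × Perm (Fin m) => insertPerm p z.1 z.2)
    ⟨?_, ?_⟩ _ _ fun _ => rfl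
  · rintro ⟨q, σ⟩ ⟨q', σ'⟩ h
    dsimp only at h
    have h1 : q = q' := by
      rw [← insertPerm_self p q σ, h, insertPerm_self]
    subst h1
    rw [insertPerm_injective _ _ h]
  · intro ρ
    obtain ⟨σ, hσ⟩ := exists_eq_insertPerm (rfl : ρ p = ρ p)
    exact ⟨(ρ p, σ), hσ.symm⟩

/-- The first `p` positions avoid the first `q` values. -/
def Avoids (p q : ℕ) (σ : Perm (Fin m)) : Prop :=
  ∀ a : Fin m, a.val < p → q ≤ (σ a).val

instance (p q : ℕ) : DecidablePred (Avoids (m := m) p q) :=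
  fun σ => inferInstanceAs (Decidable (∀ a : Fin m, a.val < p → q ≤ (σ a).val))

theorem val_succAbove_cases (p : Fin (m + 1)) (a : Fin m) :
    (a.val < p.val ∧ (p.succAbove a).val = a.val) ∨
      (p.val ≤ a.val ∧ (p.succAbove a).val = a.val + 1) := by
  rcases lt_or_ge a.val p.val with h | h
  · left
    refine ⟨h, ?_⟩
    rw [Fin.succAbove_of_castSucc_lt _ _ (by simpa [Fin.lt_def] using h)]
    simp
  · right
    refine ⟨h, ?_⟩
    rw [Fin.succAbove_of_le_castSucc _ _ (by simpa [Fin.le_def] using h)]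
    simp

/-- The deleted position `j` is open, so one open position is lost; the value `h + 1` lies beyond
the open values, whose number stays the same. -/
theorem avoids_insertPerm_value {h : ℕ} {j q : Fin (m + 1)} (hq : q.val = h + 1)
    (hj : j.val < h + 1) (σ : Perm (Fin m)) :
    Avoids (h + 1) (h + 1) (insertPerm j q σ) ↔ Avoids h (h + 1) σ := by
  constructor
  · intro H a ha
    have h1 := H (j.succAbove a)
    rw [insertPerm_succAbove] at h1
    have h2 := val_succAbove_cases j a
    have h3 := val_succAbove_cases q (σ a)
    omega
  · intro H i hi
    rcases Fin.eq_self_or_eq_succAbove j i with rfl | ⟨a, rfl⟩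
    · simp [hq]
    · rw [insertPerm_succAbove]
      have h1 := H a
      have h2 := val_succAbove_cases j a
      have h3 := val_succAbove_cases q (σ a)
      omega

/-- Dually, one of the first `h + 1` values is lost, and position `h` lies beyond the open
positions. -/
theorem avoids_insertPerm_position {h : ℕ} {p w : Fin (m + 1)} (hp : p.val = h)
    (hw : w.val ≤ h) (σ : Perm (Fin m)) :
    Avoids h (h + 1) (insertPerm p w σ) ↔ Avoids h h σ := by
  constructor
  · intro H a ha
    have h1 := H (p.succAbove a)
    rw [insertPerm_succAbove] at h1
    have h2 := val_succAbove_cases p a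
    have h3 := val_succAbove_cases w (σ a)
    omega
  · intro H i hi
    rcases Fin.eq_self_or_eq_succAbove p i with rfl | ⟨a, rfl⟩
    · omega
    · rw [insertPerm_succAbove]
      have h1 := H a
      have h2 := val_succAbove_cases p a
      have h3 := val_succAbove_cases w (σ a)
      omega

theorem avoids_succ_value {p : ℕ} {q : Fin m} {σ : Perm (Fin m)} :
    Avoids p (q + 1) σ ↔ Avoids p q σ ∧ ¬ (σ⁻¹ q).val < p := by
  constructor
  · intro H
    refine ⟨fun a ha => (Nat.le_succ _).trans (H a ha), fun hlt => ?_⟩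
    have := H _ hlt
    simp at this
  · rintro ⟨H, hlt⟩ a ha
    have h1 := H a ha
    rcases h1.lt_or_eq with h2 | h2
    · exact h2
    · exfalso
      have : σ⁻¹ q = a := by
        rw [Perm.inv_eq_iff_eq]
        exact Fin.ext h2
      exact hlt (this ▸ ha)

theorem avoids_succ_position {q : ℕ} {p : Fin m} {σ : Perm (Fin m)} :
    Avoids (p + 1) q σ ↔ Avoids p q σ ∧ ¬ (σ p).val < q := by
  constructor
  · intro H
    exact ⟨fun a ha => H a (by omega), by simpa using H p (by simp)⟩
  · rintro ⟨H, hlt⟩ a ha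
    rcases (Nat.lt_succ_iff.mp ha).lt_or_eq with h2 | h2
    · exact H a h2
    · rw [Fin.ext h2]; omega

theorem sum_filter_split {ι R : Type*} [AddCommMonoid R] (s : Finset ι) (P Q : ι → Prop)
    [DecidablePred P] [DecidablePred Q] (F : ι → R) :
    ∑ i ∈ s with P i, F i =
      ∑ i ∈ s with (P i ∧ ¬ Q i), F i + ∑ i ∈ s with (P i ∧ Q i), F i := by
  rw [← Finset.sum_filter_add_sum_filter_not (s.filter P) Q, Finset.filter_filter,
    Finset.filter_filter, add_comm]

/-- Scanning of a value, at even height: either it joins the open values, or its position `j` is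
open and the pair is deleted. -/
theorem sum_avoids_value {R : Type*} [AddCommMonoid R] {h : ℕ} {q : Fin (m + 1)}
    (hq : q.val = h + 1) (F : Perm (Fin (m + 1)) → R) :
    ∑ ρ with Avoids (h + 1) (h + 1) ρ, F ρ = ∑ ρ with Avoids (h + 1) (h + 2) ρ, F ρ +
      ∑ j : Fin (m + 1) with j.val < h + 1, ∑ σ with Avoids h (h + 1) σ, F (insertPerm j q σ) := by
  rw [sum_filter_split _ _ (fun ρ : Perm (Fin (m + 1)) => (ρ⁻¹ q).val < h + 1)]
  congr 1
  · refine Finset.sum_congr (Finset.filter_congr fun ρ _ => ?_) fun _ _ => rfl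
    have := avoids_succ_value (p := h + 1) (q := q) (σ := ρ)
    rw [hq] at this
    exact this.symm
  · rw [Finset.sum_filter, sum_perm_eq_sum_position q, Finset.sum_filter]
    refine Finset.sum_congr rfl fun j _ => ?_
    have hinv : ∀ σ : Perm (Fin m), (insertPerm j q σ)⁻¹ q = j := fun σ => by
      rw [Perm.inv_eq_iff_eq, insertPerm_self]
    split_ifs with hj
    · rw [Finset.sum_filter]
      refine Finset.sum_congr rfl fun σ _ => ?_
      simp only [hinv, hj, and_true, avoids_insertPerm_value hq hj]
    · simp [hinv, hj]

/-- Scanning of a position, at odd height, with the same alternative. -/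
theorem sum_avoids_position {R : Type*} [AddCommMonoid R] {h : ℕ} {p : Fin (m + 1)}
    (hp : p.val = h) (F : Perm (Fin (m + 1)) → R) :
    ∑ ρ with Avoids h (h + 1) ρ, F ρ = ∑ ρ with Avoids (h + 1) (h + 1) ρ, F ρ +
      ∑ w : Fin (m + 1) with w.val ≤ h, ∑ σ with Avoids h h σ, F (insertPerm p w σ) := by
  rw [sum_filter_split _ _ (fun ρ : Perm (Fin (m + 1)) => (ρ p).val < h + 1)]
  congr 1
  · refine Finset.sum_congr (Finset.filter_congr fun ρ _ => ?_) fun _ _ => rfl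
    have := avoids_succ_position (q := h + 1) (p := p) (σ := ρ)
    rw [hp] at this
    exact this.symm
  · rw [Finset.sum_filter, sum_perm_eq_sum_value p, Finset.sum_filter]
    refine Finset.sum_congr rfl fun w _ => ?_
    simp only [insertPerm_self, Nat.lt_succ_iff]
    split_ifs with hw
    · rw [Finset.sum_filter]
      refine Finset.sum_congr rfl fun σ _ => ?_
      simp only [hw, and_true, avoids_insertPerm_position hp hw]
    · simp [hw]

end Insertion

/-! ### Record weights under deletion, and the scanning induction -/

section Weights

open Equiv

variable {m h : ℕ}

theorem lt_insertPerm_value_iff {j q : Fin (m + 1)} (hq : q.val = h + 1) (hj : j.val < h + 1)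
    {σ : Perm (Fin m)} (hσ : Avoids h (h + 1) σ) (a : Fin m) :
    j.succAbove a < q.succAbove (σ a) ↔ a < σ a := by
  have h1 := hσ a
  have h2 := val_succAbove_cases j a
  have h3 := val_succAbove_cases q (σ a)
  rw [Fin.lt_def, Fin.lt_def]
  omega

theorem lt_insertPerm_position_iff {p w : Fin (m + 1)} (hp : p.val = h) (hw : w.val ≤ h)
    {σ : Perm (Fin m)} (hσ : Avoids h h σ) (a : Fin m) :
    p.succAbove a < w.succAbove (σ a) ↔ a < σ a := by
  have h1 := hσ a
  have h2 := val_succAbove_cases p a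
  have h3 := val_succAbove_cases w (σ a)
  rw [Fin.lt_def, Fin.lt_def]
  omega

theorem isRecord_insertPerm_iff {p q : Fin (m + 1)} {σ : Perm (Fin m)} {a : Fin m}
    (hpq : p < p.succAbove a → q < q.succAbove (σ a)) :
    IsRecord (insertPerm p q σ) (p.succAbove a) ↔ IsRecord σ a := by
  constructor
  · intro H b hb
    simpa using H (p.succAbove b) (by simpa using hb)
  · intro H i hi
    rcases Fin.eq_self_or_eq_succAbove p i with rfl | ⟨b, rfl⟩
    · simpa using hpq hi
    · simpa using H b (by simpa using hi)

theorem isAntirecord_insertPerm_iff {p q : Fin (m + 1)} {σ : Perm (Fin m)} {a : Fin m}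
    (hpq : p.succAbove a < p → q.succAbove (σ a) < q) :
    IsAntirecord (insertPerm p q σ) (p.succAbove a) ↔ IsAntirecord σ a := by
  constructor
  · intro H b hb
    simpa using H (p.succAbove b) (by simpa using hb)
  · intro H i hi
    rcases Fin.eq_self_or_eq_succAbove p i with rfl | ⟨b, rfl⟩
    · simpa using hpq hi
    · simpa using H b (by simpa using hi)

/-- All open positions carry values at least `h + 1`, so position `0` spoils the record at any other
`j`. -/
theorem isRecord_insertPerm_value_self {j q : Fin (m + 1)} (hq : q.val = h + 1)
    (hj : j.val < h + 1) {σ : Perm (Fin m)} (hσ : Avoids h (h + 1) σ) :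
    IsRecord (insertPerm j q σ) j ↔ j = 0 := by
  constructor
  · intro H
    by_contra hj0
    have h0 : (0 : Fin (m + 1)) < j := Fin.pos_of_ne_zero hj0
    have h1 := H 0 h0
    have h2 := (avoids_insertPerm_value hq hj σ).mpr hσ 0 (by simp)
    rw [insertPerm_self, Fin.lt_def] at h1
    omega
  · rintro rfl i hi
    exact absurd hi (Fin.not_lt_zero i)

/-- If `w` is not `0`, the value `0` is missing from the first `h` positions and from `p`, so it
sits to the right of `p`. -/
theorem isAntirecord_insertPerm_position_self {p w : Fin (m + 1)} (hp : p.val = h)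
    (hw : w.val ≤ h) {σ : Perm (Fin m)} (hσ : Avoids h h σ) :
    IsAntirecord (insertPerm p w σ) p ↔ w = 0 := by
  constructor
  · intro H
    by_contra hw0
    obtain ⟨i, hi⟩ := (insertPerm p w σ).surjective 0
    have h0 : (0 : Fin (m + 1)) < w := Fin.pos_of_ne_zero hw0
    have h2 := (avoids_insertPerm_position hp hw σ).mpr hσ i
    rw [hi] at h2
    rcases lt_trichotomy i p with h3 | h3 | h3
    · have := h2 (by rw [Fin.lt_def] at h3; omega)
      simp at this
    · subst h3
      rw [insertPerm_self] at hi
      exact hw0 hi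
    · have h4 := H i h3
      rw [hi] at h4
      exact Fin.not_lt_zero _ h4
  · rintro rfl i hi
    rw [insertPerm_self]
    refine Fin.pos_of_ne_zero fun h0 => hi.ne' ?_
    apply (insertPerm p 0 σ).injective
    rw [h0, insertPerm_self]

variable {R : Type*} [CommRing R]

/-- Product over the excedances: `y` for a record, `v` otherwise. -/
def excWeight (y v : R) (σ : Perm (Fin m)) : R :=
  ∏ i, if i < σ i then (if IsRecord σ i then y else v) else 1

/-- Product over the weak anti-excedances: `x` for an antirecord, `u` otherwise. -/
def antiexcWeight (x u : R) (σ : Perm (Fin m)) : R :=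
  ∏ i, if i < σ i then 1 else (if IsAntirecord σ i then x else u)

/-- Every excedance of `σ` has value at least `h + 1`, hence above `q` after insertion, so the new
pair spoils no record there. -/
theorem excWeight_insertPerm_value (y v : R) {j q : Fin (m + 1)} (hq : q.val = h + 1)
    (hj : j.val < h + 1) {σ : Perm (Fin m)} (hσ : Avoids h (h + 1) σ) :
    excWeight y v (insertPerm j q σ) = (if j = 0 then y else v) * excWeight y v σ := by
  have hjq : j < q := by rw [Fin.lt_def]; omega
  rw [excWeight, Fin.prod_univ_succAbove _ j, insertPerm_self, if_pos hjq]
  simp only [isRecord_insertPerm_value_self hq hj hσ]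
  congr 1
  refine Finset.prod_congr rfl fun a _ => ?_
  rw [insertPerm_succAbove]
  simp only [lt_insertPerm_value_iff hq hj hσ]
  split_ifs with h1 h2 h3 h3 <;> try rfl
  all_goals
    rw [isRecord_insertPerm_iff] at h2
    · contradiction
    · have h1 := hσ a
      have h2 := val_succAbove_cases j a
      have h3 := val_succAbove_cases q (σ a)
      simp only [Fin.lt_def] at *
      omega

theorem antiexcWeight_insertPerm_value (x u : R) {j q : Fin (m + 1)} (hq : q.val = h + 1)
    (hj : j.val < h + 1) {σ : Perm (Fin m)} (hσ : Avoids h (h + 1) σ) :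
    antiexcWeight x u (insertPerm j q σ) = antiexcWeight x u σ := by
  have hjq : j < q := by rw [Fin.lt_def]; omega
  rw [antiexcWeight, Fin.prod_univ_succAbove _ j, insertPerm_self, if_pos hjq, one_mul]
  refine Finset.prod_congr rfl fun a _ => ?_
  rw [insertPerm_succAbove]
  simp only [lt_insertPerm_value_iff hq hj hσ]
  split_ifs with h1 h2 h3 h3 <;> try rfl
  all_goals
    rw [isAntirecord_insertPerm_iff] at h2
    · contradiction
    · have h1 := hσ a
      have h2 := val_succAbove_cases j a
      have h3 := val_succAbove_cases q (σ a)
      simp only [Fin.lt_def] at *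
      omega

theorem excWeight_insertPerm_position (y v : R) {p w : Fin (m + 1)} (hp : p.val = h)
    (hw : w.val ≤ h) {σ : Perm (Fin m)} (hσ : Avoids h h σ) :
    excWeight y v (insertPerm p w σ) = excWeight y v σ := by
  have hpw : ¬ p < w := by rw [Fin.lt_def]; omega
  rw [excWeight, Fin.prod_univ_succAbove _ p, insertPerm_self, if_neg hpw, one_mul]
  refine Finset.prod_congr rfl fun a _ => ?_
  rw [insertPerm_succAbove]
  simp only [lt_insertPerm_position_iff hp hw hσ]
  split_ifs with h1 h2 h3 h3 <;> try rfl
  all_goals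
    rw [isRecord_insertPerm_iff] at h2
    · contradiction
    · have h1 := hσ a
      have h2 := val_succAbove_cases p a
      have h3 := val_succAbove_cases w (σ a)
      simp only [Fin.lt_def] at *
      omega

/-- Positions before `p` are all excedances, so no old weak anti-excedance has the new pair on its
right. -/
theorem antiexcWeight_insertPerm_position (x u : R) {p w : Fin (m + 1)} (hp : p.val = h)
    (hw : w.val ≤ h) {σ : Perm (Fin m)} (hσ : Avoids h h σ) :
    antiexcWeight x u (insertPerm p w σ) = (if w = 0 then x else u) * antiexcWeight x u σ := by
  have hpw : ¬ p < w := by rw [Fin.lt_def]; omega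
  rw [antiexcWeight, Fin.prod_univ_succAbove _ p, insertPerm_self, if_neg hpw]
  simp only [isAntirecord_insertPerm_position_self hp hw hσ]
  congr 1
  refine Finset.prod_congr rfl fun a _ => ?_
  rw [insertPerm_succAbove]
  simp only [lt_insertPerm_position_iff hp hw hσ]
  split_ifs with h1 h2 h3 h3 <;> try rfl
  all_goals
    rw [isAntirecord_insertPerm_iff] at h2
    · contradiction
    · have h1 := hσ a
      have h2 := val_succAbove_cases p a
      have h3 := val_succAbove_cases w (σ a)
      simp only [Fin.lt_def] at *
      omega

theorem sum_ite_eq_val_le {e : Fin (m + 1)} (hm : h ≤ m) (he : e.val ≤ h) (x u : R) :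
    ∑ w : Fin (m + 1) with w.val ≤ h, (if w = e then x else u) = x + h * u := by
  have hcard : (Finset.univ.filter fun w : Fin (m + 1) => w.val ≤ h).card = h + 1 := by
    simp only [← Nat.lt_succ_iff, Fin.card_filter_val_lt]
    omega
  rw [← Finset.add_sum_erase _ _ (show e ∈ Finset.univ.filter fun w : Fin (m + 1) => w.val ≤ h by
    simpa using he), if_pos rfl, Finset.sum_congr rfl (g := fun _ => u), Finset.sum_const,
    Finset.card_erase_of_mem (by simpa using he), hcard, Nat.add_sub_cancel, nsmul_eq_mul]
  intro w hw
  rw [if_neg (Finset.ne_of_mem_erase hw)]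

/-- A weight `V` on the weak anti-excedances, depending on an auxiliary structure `s`, that is
multiplied by `x` or `u` as in the Foata–Zeilberger scanning process gives rise to the
continued fraction. -/
theorem sum_avoids_eq_coeff (x y u v : R) (α : ℕ → R) (hodd : ∀ k : ℕ, α (2 * k + 1) = x + k * u)
    (heven : ∀ k : ℕ, α (2 * k + 2) = y + k * v) (ι : ℕ → Type*)
    (good : ∀ M, ℕ → ι M → Prop) (V : ∀ M, ι M → Perm (Fin M) → R)
    (hzero : ∀ s σ, V 0 s σ = 1) (hmono : ∀ M q s, good M q s → good M (q + 1) s)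
    (hvalue : ∀ (m h : ℕ) (s : ι (m + 1)) (j q : Fin (m + 1)), q.val = h + 1 → j.val < h + 1 →
      good (m + 1) (h + 1) s → ∃ s', good m (h + 1) s' ∧ ∀ σ, Avoids h (h + 1) σ →
        V (m + 1) s (insertPerm j q σ) = V m s' σ)
    (hposition : ∀ (m h : ℕ) (s : ι (m + 1)) (p : Fin (m + 1)), p.val = h →
      good (m + 1) (h + 1) s → ∃ e : Fin (m + 1), e.val ≤ h ∧ ∀ w : Fin (m + 1), w.val ≤ h →
        ∃ s', good m h s' ∧ ∀ σ, Avoids h h σ →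
          V (m + 1) s (insertPerm p w σ) = (if w = e then x else u) * V m s' σ) :
    ∀ d M k (s : ι M), 2 * M = k + d → good M ((k + 1) / 2) s →
      ∑ σ : Perm (Fin M) with Avoids (k / 2) ((k + 1) / 2) σ, excWeight y v σ * V M s σ =
        PowerSeries.coeff M (pathSeries α k) := by
  intro d
  induction d with
  | zero =>
    intro M k s hk hs
    rcases M with _ | m
    · obtain rfl : k = 0 := by omega
      rw [coeff_zero_pathSeries_zero, Finset.filter_true_of_mem fun σ _ a => a.elim0]
      simp [hzero, excWeight]
    -- Here `k = 2 * M > M`: all positions are open and no value is left for them.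
    · rw [coeff_pathSeries_of_lt α (by omega), Finset.filter_false_of_mem, Finset.sum_empty]
      intro σ _ hσ
      have := hσ 0 (by simp; omega)
      have := (σ 0).isLt
      omega
  | succ d ih =>
    intro M k s hk hs
    obtain ⟨m, rfl⟩ : ∃ m, M = m + 1 := ⟨M - 1, by omega⟩
    rcases Nat.even_or_odd' k with ⟨c, rfl | rfl⟩
    · rcases c with _ | h
      -- No position is open, so scanning the value `0` can only go up: the avoidance condition is
      -- vacuous at heights `0` and `1`.
      · rw [mul_zero, coeff_succ_pathSeries_zero, ← ih (m + 1) 1 s (by omega) (hmono _ _ _ hs)]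
        refine Finset.sum_congr (Finset.filter_congr fun σ _ => ?_) fun _ _ => rfl
        simp [Avoids]
      · have e1 : 2 * (h + 1) / 2 = h + 1 := by omega
        have e2 : (2 * (h + 1) + 1) / 2 = h + 1 := by omega
        rw [e2] at hs
        have i1 := ih (m + 1) (2 * h + 3) s (by omega)
          (by rw [show (2 * h + 3 + 1) / 2 = h + 2 by omega]; exact hmono _ _ _ hs)
        rw [show (2 * h + 3) / 2 = h + 1 by omega,
          show (2 * h + 3 + 1) / 2 = h + 2 by omega] at i1
        rw [e1, e2, sum_avoids_value (q := ⟨h + 1, by omega⟩) rfl,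
          show 2 * (h + 1) = 2 * h + 1 + 1 by ring, coeff_succ_pathSeries_succ α m (2 * h + 1), i1]
        congr 1
        have i2 : ∀ j ∈ Finset.univ.filter (fun j : Fin (m + 1) => j.val < h + 1),
            ∑ σ with Avoids h (h + 1) σ, excWeight y v (insertPerm j ⟨h + 1, by omega⟩ σ) *
              V (m + 1) s (insertPerm j ⟨h + 1, by omega⟩ σ) =
            (if j = 0 then y else v) * PowerSeries.coeff m (pathSeries α (2 * h + 1)) := by
          intro j hj
          have hj' : j.val < h + 1 := by simpa using hj
          obtain ⟨s', hs', hV⟩ := hvalue m h s j ⟨h + 1, by omega⟩ rfl hj' hs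
          have i3 := ih m (2 * h + 1) s' (by omega)
            (by rw [show (2 * h + 1 + 1) / 2 = h + 1 by omega]; exact hs')
          rw [show (2 * h + 1) / 2 = h by omega,
            show (2 * h + 1 + 1) / 2 = h + 1 by omega] at i3
          rw [← i3, Finset.mul_sum]
          refine Finset.sum_congr rfl fun σ hσ => ?_
          have hσ' : Avoids h (h + 1) σ := by simpa using hσ
          rw [hV σ hσ', excWeight_insertPerm_value y v rfl hj' hσ', mul_assoc]
        rw [Finset.sum_congr rfl i2, ← Finset.sum_mul]
        simp only [Nat.lt_succ_iff]
        rw [sum_ite_eq_val_le (e := 0) (by omega) (by simp), heven]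
    · have e1 : (2 * c + 1) / 2 = c := by omega
      have e2 : (2 * c + 1 + 1) / 2 = c + 1 := by omega
      rw [e2] at hs
      have i1 := ih (m + 1) (2 * c + 2) s (by omega)
        (by rw [show (2 * c + 2 + 1) / 2 = c + 1 by omega]; exact hs)
      rw [show (2 * c + 2) / 2 = c + 1 by omega,
        show (2 * c + 2 + 1) / 2 = c + 1 by omega] at i1
      rw [e1, e2, sum_avoids_position (p := ⟨c, by omega⟩) rfl,
        coeff_succ_pathSeries_succ α m (2 * c), i1]
      congr 1
      obtain ⟨e, he, hpos⟩ := hposition m c s ⟨c, by omega⟩ rfl hs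
      have i2 : ∀ w ∈ Finset.univ.filter (fun w : Fin (m + 1) => w.val ≤ c),
          ∑ σ with Avoids c c σ, excWeight y v (insertPerm ⟨c, by omega⟩ w σ) *
            V (m + 1) s (insertPerm ⟨c, by omega⟩ w σ) =
          (if w = e then x else u) * PowerSeries.coeff m (pathSeries α (2 * c)) := by
        intro w hw
        have hw' : w.val ≤ c := by simpa using hw
        obtain ⟨s', hs', hV⟩ := hpos w hw'
        have i3 := ih m (2 * c) s' (by omega)
          (by rw [show (2 * c + 1) / 2 = c by omega]; exact hs')
        rw [show (2 * c) / 2 = c by omega, show (2 * c + 1) / 2 = c by omega] at i3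
        rw [← i3, Finset.mul_sum]
        refine Finset.sum_congr rfl fun σ hσ => ?_
        have hσ' : Avoids c c σ := by simpa using hσ
        rw [hV σ hσ', excWeight_insertPerm_position y v rfl hw' hσ']
        ring
      rw [Finset.sum_congr rfl i2, ← Finset.sum_mul, sum_ite_eq_val_le (by omega) he, hodd]

end Weights

/-! ### Cycle counts under insertion -/

section Cycles

open Equiv

variable {m : ℕ}

theorem sameCycle_eq_of_invariant {α β : Type*} {τ : Perm α} (f : α → β)
    (hf : ∀ a, f (τ a) = f a) {a b : α} (h : τ.SameCycle a b) : f a = f b := by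
  obtain ⟨n, rfl⟩ := h
  have hz : ∀ (n : ℤ) (a : α), f ((τ ^ n) a) = f a := by
    intro n
    induction n with
    | zero => simp
    | succ n ih => intro a; rw [zpow_add_one, Perm.mul_apply, ih, hf]
    | pred n ih =>
      intro a
      rw [zpow_sub_one, Perm.mul_apply, ih, ← hf (τ⁻¹ a), ← Perm.mul_apply, mul_inv_cancel, Perm.one_apply]
  exact (hz n a).symm

theorem cyc_insertPerm_self (p : Fin (m + 1)) (τ : Perm (Fin m)) :
    cyc (insertPerm p p τ) = cyc τ + 1 := by
  let Q := Quotient (Perm.SameCycle.setoid τ)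
  let f : Fin (m + 1) → Option Q := fun i => ((finSuccEquiv' p) i).map (Quotient.mk _)
  have fp : f p = none := by simp [f]
  have fs : ∀ a, f (p.succAbove a) = some (Quotient.mk _ a) := fun a => by simp [f]
  have hinv : ∀ i, f (insertPerm p p τ i) = f i := by
    intro i
    rcases Fin.eq_self_or_eq_succAbove p i with rfl | ⟨a, rfl⟩
    · simp
    · rw [insertPerm_succAbove, fs, fs]
      congr 1
      exact Quotient.sound (Perm.sameCycle_apply_left.mpr (Perm.SameCycle.refl _ _))
  have hlift : ∀ a b, τ.SameCycle a b →
      (insertPerm p p τ).SameCycle (p.succAbove a) (p.succAbove b) := by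
    intro a b hab
    have h1 := sameCycle_eq_of_invariant
      (f := fun a => (Quotient.mk (Perm.SameCycle.setoid (insertPerm p p τ)) (p.succAbove a)))
      (fun a => by
        rw [← insertPerm_succAbove p p τ]
        exact Quotient.sound (Perm.sameCycle_apply_left.mpr (Perm.SameCycle.refl _ _))) hab
    exact Quotient.exact h1
  let g : Quotient (Perm.SameCycle.setoid (insertPerm p p τ)) → Option Q :=
    Quotient.lift f fun a b hab => sameCycle_eq_of_invariant f hinv hab
  have hg : Function.Bijective g := by
    constructor
    · rintro ⟨i⟩ ⟨j⟩ hij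
      change f i = f j at hij
      rcases Fin.eq_self_or_eq_succAbove p i with hi | ⟨a, rfl⟩ <;>
        rcases Fin.eq_self_or_eq_succAbove p j with hj | ⟨b, rfl⟩
      · rw [hi, hj]
      · rw [hi, fp, fs] at hij
        exact absurd hij.symm (Option.some_ne_none _)
      · rw [hj, fp, fs] at hij
        exact absurd hij (Option.some_ne_none _)
      · rw [fs, fs] at hij
        exact Quotient.sound (hlift a b (Quotient.exact (Option.some_injective _ hij)))
    · rintro (_ | ⟨⟨a⟩⟩)
      · exact ⟨Quotient.mk _ p, fp⟩
      · exact ⟨Quotient.mk _ (p.succAbove a), fs a⟩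
  rw [cyc, cyc, Nat.card_congr (Equiv.ofBijective g hg), Finite.card_option]

/-- The swap splices the fixed point `p` into the cycle of `c`, just before `c`, so no cycle is
created. -/
theorem cyc_swap_mul_insertPerm (p : Fin (m + 1)) (c : Fin m) (τ : Perm (Fin m)) :
    cyc (swap p (p.succAbove c) * insertPerm p p τ) = cyc τ := by
  set ρ := swap p (p.succAbove c) * insertPerm p p τ with hρ
  have hself : ∀ i, ρ.SameCycle (ρ i) i := fun i =>
    Perm.sameCycle_apply_left.mpr (Perm.SameCycle.refl _ _)
  have hp : ρ p = p.succAbove c := by simp [hρ]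
  have hs : ∀ a, τ a ≠ c → ρ (p.succAbove a) = p.succAbove (τ a) := by
    intro a ha
    rw [hρ, Perm.mul_apply, insertPerm_succAbove,
      swap_apply_of_ne_of_ne (Fin.succAbove_ne p _) (by simpa using ha)]
  have hc : ∀ a, τ a = c → ρ (p.succAbove a) = p := by
    intro a ha
    rw [hρ, Perm.mul_apply, insertPerm_succAbove, ha, swap_apply_right]
  have hstep : ∀ a, ρ.SameCycle (p.succAbove (τ a)) (p.succAbove a) := by
    intro a
    by_cases ha : τ a = c
    · have h1 := hself (p.succAbove a)
      rw [hc a ha] at h1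
      have h2 := hself p
      rw [hp] at h2
      rw [ha]
      exact h2.trans h1
    · rw [← hs a ha]
      exact hself _
  let f : Fin (m + 1) → Quotient (Perm.SameCycle.setoid τ) :=
    fun i => Quotient.mk _ (((finSuccEquiv' p) i).getD c)
  have fp : f p = Quotient.mk _ c := by simp [f]
  have fs : ∀ a, f (p.succAbove a) = Quotient.mk _ a := fun a => by simp [f]
  have hτ : ∀ a, (Quotient.mk (Perm.SameCycle.setoid τ) (τ a)) = Quotient.mk _ a := fun a =>
    Quotient.sound (Perm.sameCycle_apply_left.mpr (Perm.SameCycle.refl _ _))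
  have hinv : ∀ i, f (ρ i) = f i := by
    intro i
    rcases Fin.eq_self_or_eq_succAbove p i with rfl | ⟨a, rfl⟩
    · rw [hp, fs, fp]
    · by_cases ha : τ a = c
      · rw [hc a ha, fp, fs, ← ha, hτ]
      · rw [hs a ha, fs, fs, hτ]
  symm
  rw [cyc, cyc]
  refine Nat.card_congr (Equiv.ofBijective (Quotient.lift
    (fun a => Quotient.mk (Perm.SameCycle.setoid ρ) (p.succAbove a)) fun a b hab =>
      sameCycle_eq_of_invariant (τ := τ)
        (fun a => Quotient.mk (Perm.SameCycle.setoid ρ) (p.succAbove a)) (fun a => Quotient.sound (hstep a)) hab) ⟨?_, ?_⟩)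
  · rintro ⟨a⟩ ⟨b⟩ hab
    have h1 := sameCycle_eq_of_invariant f hinv (Quotient.exact hab)
    rw [fs, fs] at h1
    exact h1
  · rintro ⟨i⟩
    rcases Fin.eq_self_or_eq_succAbove p i with rfl | ⟨a, rfl⟩
    · refine ⟨Quotient.mk _ c, Quotient.sound ?_⟩
      have h2 := hself i
      rwa [hp] at h2
    · exact ⟨Quotient.mk _ a, rfl⟩

/-- If `π` fixes the value at every excedance of `σ`, then every cycle of `π * σ` has a weak
anti-excedance, namely its largest element. -/
theorem cyc_mul_add_exc_le (π σ : Perm (Fin m)) (hπ : ∀ i, i < σ i → π (σ i) = σ i) :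
    cyc (π * σ) + exc σ ≤ m := by
  have hcard := Finset.card_filter_add_card_filter_not (s := (Finset.univ : Finset (Fin m)))
    (fun i => i < σ i)
  rw [Finset.card_univ, Fintype.card_fin] at hcard
  have hle : cyc (π * σ) ≤ (Finset.univ.filter fun i => ¬ i < σ i).card := by
    rw [cyc, ← Fintype.card_subtype, ← Nat.card_eq_fintype_card]
    refine Nat.card_le_card_of_surjective
      (fun i : {i // ¬ i < σ i} => Quotient.mk (Perm.SameCycle.setoid (π * σ)) i.1) ?_
    rintro ⟨i⟩
    classical
    obtain ⟨k, hk, hmax⟩ := (Finset.univ.filter fun k => (π * σ).SameCycle k i).exists_max_image id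
      ⟨i, by simpa using Perm.SameCycle.refl _ _⟩
    have hk' : (π * σ).SameCycle k i := by simpa using hk
    refine ⟨⟨k, fun hlt => ?_⟩, Quotient.sound hk'⟩
    have h1 := hmax ((π * σ) k)
      (Finset.mem_filter.mpr ⟨Finset.mem_univ _, Perm.sameCycle_apply_left.mpr hk'⟩)
    rw [Perm.mul_apply, hπ k hlt] at h1
    exact absurd h1 (not_le.mpr hlt)
  unfold exc
  omega

end Cycles

/-! ### Statistics as exponents of the weights -/

section RecordStatistics

open Equiv

variable {m n h : ℕ}

theorem IsAntirecord.apply_le {σ : Perm (Fin n)} {i : Fin n} (H : IsAntirecord σ i) :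
    σ i ≤ i := by
  have h1 : (Finset.Ioi i).card ≤ (Finset.Ioi (σ i)).card :=
    Finset.card_le_card_of_injOn σ (fun j hj => by simpa using H j (by simpa using hj))
      σ.injective.injOn
  rw [Fin.card_Ioi, Fin.card_Ioi] at h1
  rw [Fin.le_def]
  omega

theorem IsRecord.le_apply {σ : Perm (Fin n)} {i : Fin n} (H : IsRecord σ i) : i ≤ σ i := by
  have h1 : (Finset.Iio i).card ≤ (Finset.Iio (σ i)).card :=
    Finset.card_le_card_of_injOn σ (fun j hj => by simpa using H j (by simpa using hj))
      σ.injective.injOn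
  rwa [Fin.card_Iio, Fin.card_Iio] at h1

/-- The earlier values are below `i`, hence exhaust the values below `i`; later values must exceed
it. -/
theorem IsRecord.isAntirecord_of_apply_eq {σ : Perm (Fin n)} {i : Fin n} (H : IsRecord σ i)
    (hi : σ i = i) : IsAntirecord σ i := by
  have himage : (Finset.Iio i).image σ = Finset.Iio i := by
    refine Finset.eq_of_subset_of_card_le ?_ (Finset.card_image_of_injective _ σ.injective).ge
    intro k hk
    obtain ⟨j, hj, rfl⟩ := Finset.mem_image.mp hk
    have := H j (by simpa using hj)
    rw [hi] at this
    simpa using this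
  intro j hj
  by_contra hlt
  have hne : σ j ≠ i := fun h => hj.ne' (σ.injective (h.trans hi.symm))
  rw [hi, not_lt] at hlt
  have hmem : σ j ∈ (Finset.Iio i).image σ := by
    rw [himage]
    simpa using lt_of_le_of_ne hlt hne
  obtain ⟨k, hk, hkj⟩ := Finset.mem_image.mp hmem
  rw [σ.injective hkj] at hk
  exact absurd (Finset.mem_Iio.mp hk) hj.asymm

theorem exclusive_record_iff {σ : Perm (Fin n)} {i : Fin n} :
    IsRecord σ i ∧ ¬ IsAntirecord σ i ↔ i < σ i ∧ IsRecord σ i := by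
  constructor
  · rintro ⟨h1, h2⟩
    exact ⟨lt_of_le_of_ne h1.le_apply fun h => h2 (h1.isAntirecord_of_apply_eq h.symm), h1⟩
  · rintro ⟨h1, h2⟩
    exact ⟨h2, fun h => absurd h1 h.apply_le.not_gt⟩

theorem erec_eq_card (σ : Perm (Fin n)) :
    erec σ = (Finset.univ.filter fun i => i < σ i ∧ IsRecord σ i).card := by
  simp only [erec, exclusive_record_iff]

theorem erec_add_card (σ : Perm (Fin n)) :
    erec σ + (Finset.univ.filter fun i => i < σ i ∧ ¬ IsRecord σ i).card = exc σ := by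
  have h1 := Finset.card_filter_add_card_filter_not
    (s := (Finset.univ : Finset (Fin n)).filter fun i => i < σ i) (fun i => IsRecord σ i)
  rw [Finset.filter_filter, Finset.filter_filter] at h1
  rw [erec_eq_card, exc, h1]

theorem arec_eq_card (σ : Perm (Fin n)) :
    arec σ = (Finset.univ.filter fun i => ¬ i < σ i ∧ IsAntirecord σ i).card := by
  rw [arec]
  congr 1
  exact Finset.filter_congr fun i _ => ⟨fun h => ⟨h.apply_le.not_gt, h⟩, fun h => h.2⟩

theorem exc_add_arec_add_card (σ : Perm (Fin n)) :
    exc σ + arec σ + (Finset.univ.filter fun i => ¬ i < σ i ∧ ¬ IsAntirecord σ i).card = n := by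
  have h1 := Finset.card_filter_add_card_filter_not (s := (Finset.univ : Finset (Fin n)))
    (fun i => i < σ i)
  rw [Finset.card_univ, Fintype.card_fin] at h1
  have h2 := Finset.card_filter_add_card_filter_not
    (s := (Finset.univ : Finset (Fin n)).filter fun i => ¬ i < σ i) (fun i => IsAntirecord σ i)
  rw [Finset.filter_filter, Finset.filter_filter, ← arec_eq_card] at h2
  rw [exc]
  omega

variable {R : Type*} [CommRing R]

theorem excWeight_eq (y v : R) (σ : Perm (Fin n)) :
    excWeight y v σ = y ^ erec σ * v ^ (exc σ - erec σ) := by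
  have h1 := erec_add_card σ
  rw [excWeight, ← Finset.prod_filter, Finset.prod_ite, Finset.prod_const, Finset.prod_const,
    Finset.filter_filter, Finset.filter_filter, ← erec_eq_card]
  congr 2
  omega

theorem antiexcWeight_eq (x u : R) (σ : Perm (Fin n)) :
    antiexcWeight x u σ = x ^ arec σ * u ^ (n - exc σ - arec σ) := by
  have h1 := exc_add_arec_add_card σ
  rw [antiexcWeight, Finset.prod_ite, Finset.prod_const_one, one_mul, Finset.prod_ite,
    Finset.prod_const, Finset.prod_const, Finset.filter_filter, Finset.filter_filter,
    ← arec_eq_card]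
  congr 2
  omega

theorem exc_insertPerm_value {j q : Fin (m + 1)} (hq : q.val = h + 1) (hj : j.val < h + 1)
    {σ : Perm (Fin m)} (hσ : Avoids h (h + 1) σ) : exc (insertPerm j q σ) = exc σ + 1 := by
  have hjq : j < q := by rw [Fin.lt_def]; omega
  simp only [exc, Finset.card_filter]
  rw [Fin.sum_univ_succAbove _ j, insertPerm_self, if_pos hjq, add_comm]
  simp only [insertPerm_succAbove, lt_insertPerm_value_iff hq hj hσ]

theorem exc_insertPerm_position {p w : Fin (m + 1)} (hp : p.val = h) (hw : w.val ≤ h)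
    {σ : Perm (Fin m)} (hσ : Avoids h h σ) : exc (insertPerm p w σ) = exc σ := by
  have hpw : ¬ p < w := by rw [Fin.lt_def]; omega
  simp only [exc, Finset.card_filter]
  rw [Fin.sum_univ_succAbove _ p, insertPerm_self, if_neg hpw, zero_add]
  simp only [insertPerm_succAbove, lt_insertPerm_position_iff hp hw hσ]

end RecordStatistics

/-! ### Contracting the memory of deleted arrows -/

section Contraction

open Equiv

variable {m : ℕ}

/-- When position `p` with value `q` is deleted, `π'` bypasses the pair: a value that `π` sent to
`p` now goes on to `π q`. -/
theorem exists_contraction (p q : Fin (m + 1)) (π : Perm (Fin (m + 1))) :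
    ∃ π', π = swap p (π q) * insertPerm q p π' := by
  obtain ⟨π', hπ'⟩ := exists_eq_insertPerm
    (show (swap p (π q) * π) q = p by rw [Perm.mul_apply, swap_apply_right])
  exact ⟨π', by rw [← hπ', ← mul_assoc, swap_mul_self, one_mul]⟩

theorem contraction_apply_eq {p q : Fin (m + 1)} {π : Perm (Fin (m + 1))} {π' : Perm (Fin m)}
    (hπ : π = swap p (π q) * insertPerm q p π') {b : Fin m} (hp : p.val ≤ b.val)
    (hq : q.val ≤ b.val) (hb : π (q.succAbove b) = q.succAbove b) : π' b = b := by
  have hs := val_succAbove_cases q b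
  have hne : q.succAbove b ≠ p := fun h => by rw [h] at hs; omega
  have hne' : q.succAbove b ≠ π q := fun h =>
    Fin.succAbove_ne q b (π.injective (hb.trans h))
  have h1 : insertPerm q p π' = swap p (π q) * π := by
    conv_rhs => rw [hπ]
    rw [Perm.mul_apply, insertPerm_self, swap_apply_left, ← mul_assoc, swap_mul_self, one_mul]
  have h2 : insertPerm q p π' (q.succAbove b) = q.succAbove b := by
    rw [h1, Perm.mul_apply, hb, swap_apply_of_ne_of_ne hne hne']
  rw [insertPerm_succAbove] at h2
  have h3 := val_succAbove_cases p (π' b)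
  rw [h2] at h3
  exact Fin.ext (by omega)

/-- The product is `π' * σ` with `p` inserted: as a fixed point if `π q = p`, which closes a cycle,
and inside an existing cycle otherwise. -/
theorem cyc_mul_insertPerm {p q : Fin (m + 1)} {π : Perm (Fin (m + 1))} {π' : Perm (Fin m)}
    (hπ : π = swap p (π q) * insertPerm q p π') (σ : Perm (Fin m)) :
    cyc (π * insertPerm p q σ) = cyc (π' * σ) + if π q = p then 1 else 0 := by
  have h1 : π * insertPerm p q σ = swap p (π q) * insertPerm p p (π' * σ) := by
    conv_lhs => rw [hπ]
    rw [mul_assoc, insertPerm_mul]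
  rw [h1]
  rcases Fin.eq_self_or_eq_succAbove p (π q) with h | ⟨c, hc⟩
  · rw [h, swap_self, if_pos rfl, ← cyc_insertPerm_self p]
    rfl
  · rw [hc, cyc_swap_mul_insertPerm, if_neg (Fin.succAbove_ne p c), add_zero]

end Contraction

/-! ### The two expansions and the theorem -/

theorem eulerianP_eq_coeff_pathSeries (n : ℕ) :
    eulerianP n = PowerSeries.coeff n (pathSeries eulerianWeight 0) := by
  rw [pathSeries_zero, eulerianP]

theorem eulerianWeight_two_mul_add_one (k : ℕ) : eulerianWeight (2 * k + 1) =
    MvPolynomial.X 0 + (k : MvPolynomial (Fin 4) ℤ) * MvPolynomial.X 2 := by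
  have h1 := eulerianWeight_odd (k + 1) (by omega)
  rwa [show 2 * (k + 1) - 1 = 2 * k + 1 by omega, Nat.add_sub_cancel] at h1

theorem eulerianWeight_two_mul_add_two (k : ℕ) : eulerianWeight (2 * k + 2) =
    MvPolynomial.X 1 + (k : MvPolynomial (Fin 4) ℤ) * MvPolynomial.X 3 := by
  have h1 := eulerianWeight_even (k + 1)
  rwa [mul_add, mul_one, Nat.add_sub_cancel] at h1

theorem eulerianP_eq_sum_arec (n : ℕ) : eulerianP n =
    ∑ σ : Equiv.Perm (Fin n), excWeight (MvPolynomial.X 1) (MvPolynomial.X 3) σ *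
      antiexcWeight (MvPolynomial.X 0) (MvPolynomial.X 2) σ := by
  have key := sum_avoids_eq_coeff (MvPolynomial.X 0 : MvPolynomial (Fin 4) ℤ) (MvPolynomial.X 1)
    (MvPolynomial.X 2) (MvPolynomial.X 3) eulerianWeight eulerianWeight_two_mul_add_one
    eulerianWeight_two_mul_add_two (fun _ => Unit) (fun _ _ _ => True)
    (fun _ _ σ => antiexcWeight (MvPolynomial.X 0) (MvPolynomial.X 2) σ)
    (fun _ _ => by simp [antiexcWeight]) (fun _ _ _ _ => trivial)
    (fun m h _ j q hq hj _ => ⟨(), trivial, fun σ hσ =>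
      antiexcWeight_insertPerm_value _ _ hq hj hσ⟩)
    (fun m h _ p hp _ => ⟨0, by simp, fun w hw => ⟨(), trivial, fun σ hσ =>
      antiexcWeight_insertPerm_position _ _ hp hw hσ⟩⟩)
    (2 * n) n 0 () (by omega) trivial
  rw [eulerianP_eq_coeff_pathSeries, ← key]
  simp [Avoids]

/-- The auxiliary state is π, starting at `1`; it is good when it fixes everything not yet scanned
as a value. -/
theorem eulerianP_eq_sum_cyc (n : ℕ) : eulerianP n =
    ∑ σ : Equiv.Perm (Fin n), excWeight (MvPolynomial.X 1) (MvPolynomial.X 3) σ *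
      (MvPolynomial.X 0 ^ cyc σ * MvPolynomial.X 2 ^ (n - exc σ - cyc σ)) := by
  have key := sum_avoids_eq_coeff (MvPolynomial.X 0 : MvPolynomial (Fin 4) ℤ) (MvPolynomial.X 1)
    (MvPolynomial.X 2) (MvPolynomial.X 3) eulerianWeight eulerianWeight_two_mul_add_one
    eulerianWeight_two_mul_add_two (fun M => Equiv.Perm (Fin M))
    (fun _ q π => ∀ b, q ≤ b.val → π b = b)
    (fun M π σ => MvPolynomial.X 0 ^ cyc (π * σ) * MvPolynomial.X 2 ^ (M - exc σ - cyc (π * σ)))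
    ?_ (fun _ _ _ hs b hb => hs b (by omega)) ?_ ?_ (2 * n) n 0 1 (by omega) (by simp)
  · rw [eulerianP_eq_coeff_pathSeries, ← key]
    simp [Avoids]
  · intro π σ
    have := cyc_mul_add_exc_le π σ fun i => i.elim0
    rw [show cyc (π * σ) = 0 by omega]
    simp
  · intro m h π j q hq hj hπ
    obtain ⟨π', hπ'⟩ := exists_contraction j q π
    refine ⟨π', fun b hb => ?_, fun σ hσ => ?_⟩
    · have := val_succAbove_cases q b
      exact contraction_apply_eq hπ' (by omega) (by omega) (hπ _ (by omega))
    -- The newly scanned value `q` is fixed by π, so an excedance never closes a cycle.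
    · have hne : π q ≠ j := by
        rw [hπ q hq.ge]
        intro h
        rw [h] at hq
        omega
      rw [cyc_mul_insertPerm hπ', if_neg hne, add_zero, exc_insertPerm_value hq hj hσ,
        Nat.add_sub_add_right]
  · intro m h π p hp hπ
    -- The one value whose chain of deleted arrows leads back to `p`.
    refine ⟨π⁻¹ p, ?_, fun w hw => ?_⟩
    · by_contra hlt
      have h1 := hπ (π⁻¹ p) (by omega)
      rw [← Equiv.Perm.mul_apply, mul_inv_cancel, Equiv.Perm.one_apply] at h1
      rw [← h1] at hlt
      omega
    · obtain ⟨π', hπ'⟩ := exists_contraction p w π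
      have hgood : ∀ b : Fin m, h ≤ b.val → π' b = b := fun b hb => by
        have := val_succAbove_cases w b
        exact contraction_apply_eq hπ' (by omega) (by omega) (hπ _ (by omega))
      refine ⟨π', hgood, fun σ hσ => ?_⟩
      -- This bound keeps the truncated subtraction in the exponent of `u` exact when no cycle
      -- closes.
      have hle := cyc_mul_add_exc_le π' σ fun i hi => hgood _ (by
        have := hσ i
        rw [Fin.lt_def] at hi
        omega)
      rw [cyc_mul_insertPerm hπ', exc_insertPerm_position hp hw hσ]
      simp only [Equiv.Perm.eq_inv_iff_eq]
      split_ifs with hwp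
      · rw [show m + 1 - exc σ - (cyc (π' * σ) + 1) = m - exc σ - cyc (π' * σ) by omega]
        ring
      · rw [show m + 1 - exc σ - (cyc (π' * σ) + 0) = m - exc σ - cyc (π' * σ) + 1 by omega]
        ring

theorem theorem2p1 (n : ℕ) :
    (∀ σ : Equiv.Perm (Fin n),
      erec σ ≤ exc σ ∧ exc σ + arec σ ≤ n ∧ exc σ + cyc σ ≤ n) ∧
    eulerianP n =
      ∑ σ : Equiv.Perm (Fin n),
        MvPolynomial.X 0 ^ arec σ * MvPolynomial.X 1 ^ erec σ *
          MvPolynomial.X 2 ^ (n - exc σ - arec σ) * MvPolynomial.X 3 ^ (exc σ - erec σ) ∧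
    eulerianP n =
      ∑ σ : Equiv.Perm (Fin n),
        MvPolynomial.X 0 ^ cyc σ * MvPolynomial.X 1 ^ erec σ *
          MvPolynomial.X 2 ^ (n - exc σ - cyc σ) * MvPolynomial.X 3 ^ (exc σ - erec σ) := by
  refine ⟨fun σ => ⟨?_, ?_, ?_⟩, ?_, ?_⟩
  · exact (Nat.le_add_right _ _).trans_eq (erec_add_card σ)
  · exact (Nat.le_add_right _ _).trans_eq (exc_add_arec_add_card σ)
  · have := cyc_mul_add_exc_le 1 σ fun _ _ => rfl
    rwa [one_mul, add_comm] at this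
  · rw [eulerianP_eq_sum_arec]
    refine Finset.sum_congr rfl fun σ _ => ?_
    rw [excWeight_eq, antiexcWeight_eq]
    ring
  · rw [eulerianP_eq_sum_cyc]
    refine Finset.sum_congr rfl fun σ _ => ?_
    rw [excWeight_eq]
    ring
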